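/- Let $\mathbb{K}$ be an algebraically closed field. For $r\ge 1$ let $J_r=(\mathbb{K}^r,\mathbb{K}^{r-1};[\,I\;\,0\,],[\,0\;\,I\,])$ be the preinjective indecomposable Kronecker representation (a pair of $(r-1)\times r$ matrices). Let $m,n\ge 0$, let $c_1\ge c_2\ge\dots\ge c_m\ge 1$ and $f_1\ge f_2\ge\dots\ge f_n\ge 1$ be integers, and let $\phi^{II}=(\phi^{II1},\phi^{II2})$ be the generic homomorphism from $N^I=\bigoplus_{j=1}^{n}J_{f_j}$ to $M^I=\bigoplus_{i=1}^{m}J_{c_i}$. Thus $\phi^{II1}=(\phi^{II1}_{ij})$ is the block matrix whose block $\phi^{II1}_{ij}$ $(1\le i\le m,\ 1\le j\le n)$ has size $c_i\times f_j$, is zero if $c_i>f_j$, and if $c_i\le f_j$ has the entry $x^{ij}_{l-k+1}$ in position $(k,l)$ when $1\le l-k+1\le f_j-c_i+1$ and the entry $0$ in all other positions; all the $x^{ij}_d$ $(c_i\le f_j,\ 1\le d\le f_j-c_i+1)$ are different indeterminates over $\mathbb{K}$. Put $c_j=0$ for $j>m$, $f_i=0$ for $i>n$ and $v_0=0$, and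 for $l\ge 1$ define $$u_l=\max\{1\le j\le m : c_j>f_{v_{l-1}+1}\},\qquad v_l=\max\{1\le i\le n : c_{u_l+1}\le f_i\},$$ where the maximum of the empty set is $0$. Then there is a least $w\ge 1$ with $u_w=m$, and the rank of $\phi^{II1}$ over the field of rational functions in the indeterminates is $$\operatorname{rank}\phi^{II1}=\min\Big\{\sum_{j=1}^{v_i}f_j+\sum_{j=u_{i+1}+1}^{u_w}c_j \;:\; 0\le i\le w-1\Big\},$$ where sums over empty ranges are $0$. -/

import Mathlib

namespace Kron

/-! ### Kronecker representations in matrix form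

A Kronecker representation is a pair `(A, B)` of matrices of the same size (the linear maps
of the two arrows, from the space at vertex `1` to the space at vertex `2`). -/

/-- `(φ₁, φ₂)` is a homomorphism from the representation `(Nα, Nβ)` to `(Mα, Mβ)`. -/
def IsHom {R : Type*} [CommRing R] {p₁ p₂ q₁ q₂ : Type*}
    [Fintype p₁] [Fintype p₂] [Fintype q₁] [Fintype q₂]
    (Nα Nβ : Matrix q₂ q₁ R) (Mα Mβ : Matrix p₂ p₁ R)
    (φ₁ : Matrix p₁ q₁ R) (φ₂ : Matrix p₂ q₂ R) : Prop :=
  Mα * φ₁ = φ₂ * Nα ∧ Mβ * φ₁ = φ₂ * Nβ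

/-- The matrix `[I 0]` of size `(r - 1) × r`: first arrow of the preinjective
indecomposable representation `J_r`. -/
def Jα (R : Type*) [CommRing R] (r : ℕ) : Matrix (Fin (r - 1)) (Fin r) R :=
  Matrix.of fun k l => if (l : ℕ) = k then 1 else 0

/-- The matrix `[0 I]` of size `(r - 1) × r`: second arrow of `J_r`. -/
def Jβ (R : Type*) [CommRing R] (r : ℕ) : Matrix (Fin (r - 1)) (Fin r) R :=
  Matrix.of fun k l => if (l : ℕ) = k + 1 then 1 else 0

/-- First arrow of the preinjective representation `⨁ i, J_{c i}`. -/
def preinjα (R : Type*) [CommRing R] {m : ℕ} (c : Fin m → ℕ) :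
    Matrix (Σ i : Fin m, Fin (c i - 1)) (Σ i : Fin m, Fin (c i)) R :=
  Matrix.blockDiagonal' fun i => Jα R (c i)

/-- Second arrow of the preinjective representation `⨁ i, J_{c i}`. -/
def preinjβ (R : Type*) [CommRing R] {m : ℕ} (c : Fin m → ℕ) :
    Matrix (Σ i : Fin m, Fin (c i - 1)) (Σ i : Fin m, Fin (c i)) R :=
  Matrix.blockDiagonal' fun i => Jβ R (c i)

/-! ### The generic homomorphism `φ^{II}` from `⨁ j, J_{f j}` to `⨁ i, J_{c i}` -/

/-- Names of the indeterminates: `⟨(i, j), d⟩` stands for `x^{IIij}_{d+1}`. The block `(i, j)`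
has `f j - c i + 1` of them if `c i ≤ f j`, and none otherwise. -/
abbrev Param {m n : ℕ} (c : Fin m → ℕ) (f : Fin n → ℕ) : Type :=
  Σ p : Fin m × Fin n, Fin (f p.2 + 1 - c p.1)

/-- The entry in row `k` and column `l` (both counted from `0`) of the block `(i, j)`: it is
`x^{IIij}_{l-k+1}` if `1 ≤ l - k + 1 ≤ f j - c i + 1`, and `0` otherwise. -/
noncomputable def entry (K : Type*) [CommRing K] {m n : ℕ} (c : Fin m → ℕ) (f : Fin n → ℕ)
    (i : Fin m) (j : Fin n) (k l : ℕ) : MvPolynomial (Param c f) K :=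
  if h : k ≤ l ∧ l - k < f j + 1 - c i then MvPolynomial.X ⟨(i, j), ⟨l - k, h.2⟩⟩ else 0

/-- The matrix `φ^{II1}` of the generic homomorphism at the first vertex; its block `(i, j)`
is of size `c i × f j`. -/
noncomputable def phiII1 (K : Type*) [CommRing K] {m n : ℕ} (c : Fin m → ℕ) (f : Fin n → ℕ) :
    Matrix (Σ i : Fin m, Fin (c i)) (Σ j : Fin n, Fin (f j)) (MvPolynomial (Param c f) K) :=
  Matrix.of fun a b => entry K c f a.1 b.1 a.2 b.2

/-- The matrix `φ^{II2}` of the generic homomorphism at the second vertex; its block `(i, j)`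
is of size `(c i - 1) × (f j - 1)`. -/
noncomputable def phiII2 (K : Type*) [CommRing K] {m n : ℕ} (c : Fin m → ℕ) (f : Fin n → ℕ) :
    Matrix (Σ i : Fin m, Fin (c i - 1)) (Σ j : Fin n, Fin (f j - 1))
      (MvPolynomial (Param c f) K) :=
  Matrix.of fun a b => entry K c f a.1 b.1 a.2 b.2

/-- The rank of a matrix over a domain, i.e. its rank over the field of fractions. -/
noncomputable def fracRank {A : Type*} [CommRing A] [IsDomain A] {p q : Type*}
    [Fintype p] [Fintype q] (B : Matrix p q A) : ℕ :=
  (B.map (algebraMap A (FractionRing A))).rank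

/-! ### The numbers `u_l` and `v_l` -/

/-- The `j`-th member (counted from `1`) of the finite sequence `c`; undefined members are `0`. -/
def term {m : ℕ} (c : Fin m → ℕ) (j : ℕ) : ℕ :=
  if h : 1 ≤ j ∧ j ≤ m then c ⟨j - 1, by omega⟩ else 0

/-- `max {1 ≤ j ≤ m | P j}`, which is `0` if there is no such `j`. -/
def maxIndex (m : ℕ) (P : ℕ → Prop) [DecidablePred P] : ℕ :=
  ((Finset.Icc 1 m).filter P).sup id

/-- The next `u`, given the previous `v`: `max {1 ≤ j ≤ m | c_j > f_{v+1}}`. -/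
def nextU {m n : ℕ} (c : Fin m → ℕ) (f : Fin n → ℕ) (v : ℕ) : ℕ :=
  maxIndex m fun j => term c j > term f (v + 1)

/-- The next `v`, given the current `u`: `max {1 ≤ i ≤ n | c_{u+1} ≤ f_i}`. -/
def nextV {m n : ℕ} (c : Fin m → ℕ) (f : Fin n → ℕ) (u : ℕ) : ℕ :=
  maxIndex n fun i => term c (u + 1) ≤ term f i

/-- `v_0 = 0` and `v_l = max {1 ≤ i ≤ n | c_{u_l + 1} ≤ f_i}`, where
`u_l = max {1 ≤ j ≤ m | c_j > f_{v_{l-1} + 1}}`. -/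
def vSeq {m n : ℕ} (c : Fin m → ℕ) (f : Fin n → ℕ) : ℕ → ℕ
  | 0 => 0
  | l + 1 => nextV c f (nextU c f (vSeq c f l))

/-- `u_0 = 0` and `u_l = max {1 ≤ j ≤ m | c_j > f_{v_{l-1} + 1}}`. -/
def uSeq {m n : ℕ} (c : Fin m → ℕ) (f : Fin n → ℕ) : ℕ → ℕ
  | 0 => 0
  | l + 1 => nextU c f (vSeq c f l)

/-! ### The pair `(φ^{II1}, φ^{II2})` is the generic homomorphism -/

section Checks

variable {R : Type*} [CommRing R] {m n : ℕ} {c : Fin m → ℕ} {f : Fin n → ℕ}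

theorem preinjα_mul (φ : Matrix (Σ i : Fin m, Fin (c i)) (Σ j : Fin n, Fin (f j)) R)
    (i : Fin m) (k : ℕ) (hk : k < c i - 1) (b : Σ j : Fin n, Fin (f j)) :
    (preinjα R c * φ) ⟨i, ⟨k, hk⟩⟩ b = φ ⟨i, ⟨k, by omega⟩⟩ b := by
  rw [Matrix.mul_apply, Finset.sum_eq_single ⟨i, ⟨k, by omega⟩⟩]
  · simp [preinjα, Jα]
  · rintro ⟨i', l⟩ - hne
    by_cases h : i = i'
    · subst h
      have : (l : ℕ) ≠ k := by
        rintro h; apply hne; congr 1; exact Fin.ext h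
      simp [preinjα, Jα, this]
    · simp [preinjα, Matrix.blockDiagonal'_apply_ne _ _ _ h]
  · simp

theorem preinjβ_mul (φ : Matrix (Σ i : Fin m, Fin (c i)) (Σ j : Fin n, Fin (f j)) R)
    (i : Fin m) (k : ℕ) (hk : k < c i - 1) (b : Σ j : Fin n, Fin (f j)) :
    (preinjβ R c * φ) ⟨i, ⟨k, hk⟩⟩ b = φ ⟨i, ⟨k + 1, by omega⟩⟩ b := by
  rw [Matrix.mul_apply, Finset.sum_eq_single ⟨i, ⟨k + 1, by omega⟩⟩]
  · simp [preinjβ, Jβ]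
  · rintro ⟨i', l⟩ - hne
    by_cases h : i = i'
    · subst h
      have : (l : ℕ) ≠ k + 1 := by
        rintro h; apply hne; congr 1; exact Fin.ext h
      simp [preinjβ, Jβ, this]
    · simp [preinjβ, Matrix.blockDiagonal'_apply_ne _ _ _ h]
  · simp

theorem mul_preinjα (φ : Matrix (Σ i : Fin m, Fin (c i - 1)) (Σ j : Fin n, Fin (f j - 1)) R)
    (a : Σ i : Fin m, Fin (c i - 1)) (j : Fin n) (l : ℕ) (hl : l < f j) :
    (φ * preinjα R f) a ⟨j, ⟨l, hl⟩⟩ =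
      if h : l < f j - 1 then φ a ⟨j, ⟨l, h⟩⟩ else 0 := by
  rw [Matrix.mul_apply]
  split_ifs with h
  · rw [Finset.sum_eq_single ⟨j, ⟨l, h⟩⟩]
    · simp [preinjα, Jα]
    · rintro ⟨j', k⟩ - hne
      by_cases hj : j' = j
      · subst hj
        have : l ≠ (k : ℕ) := by
          rintro h; apply hne; congr 1; exact Fin.ext h.symm
        simp [preinjα, Jα, this]
      · simp [preinjα, Matrix.blockDiagonal'_apply_ne _ _ _ hj]
    · simp
  · refine Finset.sum_eq_zero ?_
    rintro ⟨j', k⟩ -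
    by_cases hj : j' = j
    · subst hj
      have : l ≠ (k : ℕ) := by have := k.2; omega
      simp [preinjα, Jα, this]
    · simp [preinjα, Matrix.blockDiagonal'_apply_ne _ _ _ hj]

theorem mul_preinjβ (φ : Matrix (Σ i : Fin m, Fin (c i - 1)) (Σ j : Fin n, Fin (f j - 1)) R)
    (a : Σ i : Fin m, Fin (c i - 1)) (j : Fin n) (l : ℕ) (hl : l < f j) :
    (φ * preinjβ R f) a ⟨j, ⟨l, hl⟩⟩ =
      if h : 1 ≤ l then φ a ⟨j, ⟨l - 1, by omega⟩⟩ else 0 := by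
  rw [Matrix.mul_apply]
  split_ifs with h
  · rw [Finset.sum_eq_single ⟨j, ⟨l - 1, by omega⟩⟩]
    · have : l = l - 1 + 1 := by omega
      simp [preinjβ, Jβ, ← this]
    · rintro ⟨j', k⟩ - hne
      by_cases hj : j' = j
      · subst hj
        have : l ≠ (k : ℕ) + 1 := by
          rintro h; apply hne; congr 1; apply Fin.ext; simp [h]
        simp [preinjβ, Jβ, this]
      · simp [preinjβ, Matrix.blockDiagonal'_apply_ne _ _ _ hj]
    · simp
  · refine Finset.sum_eq_zero ?_
    rintro ⟨j', k⟩ -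
    by_cases hj : j' = j
    · subst hj
      have : l ≠ (k : ℕ) + 1 := by omega
      simp [preinjβ, Jβ, this]
    · simp [preinjβ, Matrix.blockDiagonal'_apply_ne _ _ _ hj]

/-- The pair `(φ^{II1}, φ^{II2})` is a homomorphism from `⨁ j, J_{f j}` to `⨁ i, J_{c i}`. -/
theorem isHom_phiII (K : Type*) [CommRing K] (c : Fin m → ℕ) (f : Fin n → ℕ) :
    IsHom (preinjα (MvPolynomial (Param c f) K) f) (preinjβ (MvPolynomial (Param c f) K) f)
      (preinjα (MvPolynomial (Param c f) K) c) (preinjβ (MvPolynomial (Param c f) K) c)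
      (phiII1 K c f) (phiII2 K c f) := by
  constructor
  · ext1 ⟨i, k, hk⟩ ⟨j, l, hl⟩
    rw [preinjα_mul, mul_preinjα]
    split_ifs with h
    · rfl
    · simp only [phiII1, Matrix.of_apply, entry]
      rw [dif_neg]; omega
  · ext1 ⟨i, k, hk⟩ ⟨j, l, hl⟩
    rw [preinjβ_mul, mul_preinjβ]
    split_ifs with h
    · have h1 : l - (k + 1) = l - 1 - k := by omega
      simp only [phiII1, phiII2, Matrix.of_apply, entry, h1]
      by_cases h2 : k + 1 ≤ l ∧ l - 1 - k < f j + 1 - c i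
      · rw [dif_pos h2, dif_pos ⟨by omega, h2.2⟩]
      · rw [dif_neg h2, dif_neg (by omega)]
    · simp only [phiII1, Matrix.of_apply, entry]
      rw [dif_neg]; omega

/-- Every homomorphism, over every commutative `K`-algebra, arises from
`(φ^{II1}, φ^{II2})` by giving values to the indeterminates, in exactly one way. -/
theorem phiII_universal (K : Type*) [CommRing K] [Algebra K R]
    (hc : ∀ i, 1 ≤ c i)
    (ψ₁ : Matrix (Σ i : Fin m, Fin (c i)) (Σ j : Fin n, Fin (f j)) R)
    (ψ₂ : Matrix (Σ i : Fin m, Fin (c i - 1)) (Σ j : Fin n, Fin (f j - 1)) R)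
    (h : IsHom (preinjα R f) (preinjβ R f) (preinjα R c) (preinjβ R c) ψ₁ ψ₂) :
    ∃! x : Param c f → R,
      (phiII1 K c f).map (MvPolynomial.aeval x) = ψ₁ ∧
        (phiII2 K c f).map (MvPolynomial.aeval x) = ψ₂ := by
  obtain ⟨hα, hβ⟩ := h
  have eα : ∀ (i : Fin m) (j : Fin n) (k l : ℕ) (hk : k < c i - 1) (hl : l < f j),
      ψ₁ ⟨i, ⟨k, by omega⟩⟩ ⟨j, ⟨l, hl⟩⟩ =
        if h : l < f j - 1 then ψ₂ ⟨i, ⟨k, hk⟩⟩ ⟨j, ⟨l, h⟩⟩ else 0 := by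
    intro i j k l hk hl
    rw [← preinjα_mul ψ₁ i k hk, hα, mul_preinjα]
  have eβ : ∀ (i : Fin m) (j : Fin n) (k l : ℕ) (hk : k < c i - 1) (hl : l < f j),
      ψ₁ ⟨i, ⟨k + 1, by omega⟩⟩ ⟨j, ⟨l, hl⟩⟩ =
        if h : 1 ≤ l then ψ₂ ⟨i, ⟨k, hk⟩⟩ ⟨j, ⟨l - 1, by omega⟩⟩ else 0 := by
    intro i j k l hk hl
    rw [← preinjβ_mul ψ₁ i k hk, hβ, mul_preinjβ]
  have shift : ∀ (i : Fin m) (j : Fin n) (k l : ℕ) (hk : k + 1 < c i) (hl : l + 1 < f j),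
      ψ₁ ⟨i, ⟨k + 1, hk⟩⟩ ⟨j, ⟨l + 1, hl⟩⟩ = ψ₁ ⟨i, ⟨k, by omega⟩⟩ ⟨j, ⟨l, by omega⟩⟩ := by
    intro i j k l hk hl
    rw [eα i j k l (by omega), eβ i j k (l + 1) (by omega), dif_pos (by omega),
      dif_pos (by omega)]
    rfl
  have diag : ∀ (i : Fin m) (j : Fin n) (s k l : ℕ) (hk : k + s < c i) (hl : l + s < f j),
      ψ₁ ⟨i, ⟨k + s, hk⟩⟩ ⟨j, ⟨l + s, hl⟩⟩ = ψ₁ ⟨i, ⟨k, by omega⟩⟩ ⟨j, ⟨l, by omega⟩⟩ := by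
    intro i j s
    induction s with
    | zero => intros; rfl
    | succ s ih =>
      intro k l hk hl
      exact (shift i j (k + s) (l + s) hk hl).trans (ih k l (by omega) (by omega))
  have main : ∀ (i : Fin m) (j : Fin n) (k l : ℕ) (hk : k < c i) (hl : l < f j),
      ψ₁ ⟨i, ⟨k, hk⟩⟩ ⟨j, ⟨l, hl⟩⟩ =
        if h : k ≤ l ∧ l - k < f j + 1 - c i then
          ψ₁ ⟨i, ⟨0, hc i⟩⟩ ⟨j, ⟨l - k, by omega⟩⟩ else 0 := by
    intro i j k l hk hl
    split_ifs with h
    · have := diag i j k 0 (l - k) (by omega) (by omega)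
      convert this using 3 <;> simp [h.1]
    · by_cases hkl : k ≤ l
      · -- the diagonal meets the last column above the last row
        have h1 : c i + l > f j + k := by omega
        have h2 := diag i j (f j - 1 - l) k l (by omega) (by omega)
        rw [← h2, eα i j (k + (f j - 1 - l)) (l + (f j - 1 - l)) (by omega),
          dif_neg (by omega)]
      · -- the diagonal meets the first column below the first row
        have h2 := diag i j l (k - l) 0 (by omega) (by omega)
        have h3 := eβ i j (k - l - 1) 0 (by omega) (by omega)
        rw [dif_neg (by omega)] at h3
        rw [← h3]
        convert h2 using 3 <;> simp <;> omega
  refine ⟨fun p => ψ₁ ⟨p.1.1, ⟨0, hc _⟩⟩ ⟨p.1.2, ⟨p.2, ?_⟩⟩, ⟨?_, ?_⟩, ?_⟩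
  · have := p.2.2
    have := hc p.1.1
    omega
  · ext1 ⟨i, k, hk⟩ ⟨j, l, hl⟩
    rw [main]
    simp only [Matrix.map_apply, phiII1, Matrix.of_apply, entry]
    split_ifs <;> simp
  · ext1 ⟨i, k, hk⟩ ⟨j, l, hl⟩
    have h1 := eα i j k l hk (by omega)
    rw [dif_pos hl] at h1
    rw [← h1, main]
    simp only [Matrix.map_apply, phiII2, Matrix.of_apply, entry]
    split_ifs <;> simp
  · rintro y ⟨hy, -⟩
    funext ⟨⟨i, j⟩, d, hd⟩
    have hd' : d < f j + 1 - c i := hd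
    have hci := hc i
    have := congrFun (congrFun hy ⟨i, ⟨0, hc i⟩⟩) ⟨j, ⟨d, by omega⟩⟩
    simp only [← this, Matrix.map_apply, phiII1, Matrix.of_apply, entry]
    rw [dif_pos ⟨Nat.zero_le _, by simpa using hd'⟩]
    simp

end Checks

end Kron

namespace Kron

/-! ### Ranks, spanning on a set of columns, and specialization -/

section LinearAlgebra

variable {K : Type*} [Field K]

/-! The upper bound comes from a block of zeros. Let `u = nextU c f v`. For a row block `a ≤ u` and
a column block `b > v`, monotonicity gives `c_a ≥ c_u > f_{v+1} ≥ f_b`, so the block `(a, b)`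
vanishes. The rank is therefore at most the number of columns in the first `v` column blocks plus
the number of rows after the first `u` row blocks (`fracRank_le`).

The lower bound is a greedy filling. Row blocks are specialized one at a time so that the first `i`
of them span all functions on the first `reach c f i` columns. A row block of height `c_i` acts only
on the column blocks with `f_j ≥ c_i`, an initial segment because `f` decreases. It can always
capture the next `c_i` columns, or all that is left of that segment (`exists_spans_update`). A
specialization bounds the generic rank from below (`Spans.card_le_fracRank`), so `reach c f m` does
too.

Unrolling the recursion for `reach` (`reach_eq`) shows that `reach c f m` is at least one of the
values in the minimum (`exists_value_le_reach`). Each of those values is an upper bound, so the two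
bounds meet. -/

theorem rank_add_le_rank_add_rank {ρ γ : Type*} [Fintype ρ] [Fintype γ] (A B : Matrix ρ γ K) :
    (A + B).rank ≤ A.rank + B.rank := by
  simp only [Matrix.rank]
  refine le_trans (Submodule.finrank_mono ?_) (Submodule.finrank_add_le_finrank_add_finrank _ _)
  rw [Matrix.mulVecLin_add]
  rintro _ ⟨v, rfl⟩
  exact Submodule.add_mem_sup ⟨v, rfl⟩ ⟨v, rfl⟩

/-- Split `B` into its rows in `S` and the remaining rows, which are supported on the columns in
`T`. Diagonal projections bound the two ranks. -/
theorem rank_le_card_add_card {ρ γ : Type*} [Fintype ρ] [Fintype γ] [DecidableEq ρ]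
    [DecidableEq γ] (B : Matrix ρ γ K) (S : Finset ρ) (T : Finset γ)
    (h : ∀ r ∉ S, ∀ t ∉ T, B r t = 0) : B.rank ≤ S.card + T.card := by
  classical
  have hB : B = Matrix.diagonal (fun r => if r ∈ S then (1 : K) else 0) * B +
      Matrix.diagonal (fun r => if r ∈ S then (0 : K) else 1) * B *
        Matrix.diagonal (fun t => if t ∈ T then (1 : K) else 0) := by
    ext r t
    rw [Matrix.add_apply, Matrix.mul_diagonal, Matrix.diagonal_mul, Matrix.diagonal_mul]
    by_cases hr : r ∈ S
    · simp [hr]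
    · by_cases ht : t ∈ T
      · simp [hr, ht]
      · simp [hr, ht, h r hr t ht]
  rw [hB]
  refine (rank_add_le_rank_add_rank _ _).trans (add_le_add ?_ ?_)
  · refine (Matrix.rank_mul_le_left _ _).trans ?_
    rw [Matrix.rank_diagonal]
    simp
  · refine (Matrix.rank_mul_le_right _ _).trans ?_
    rw [Matrix.rank_diagonal]
    simp

/-- The restrictions of the vectors `A r` to `T` span all functions on `T`. -/
def Spans {ρ γ : Type*} (A : ρ → γ → K) (T : Set γ) : Prop :=
  ∀ y : γ → K, ∃ u ∈ Submodule.span K (Set.range A), ∀ t ∈ T, u t = y t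

theorem Spans.of_eqOn {ρ ρ' γ : Type*} {A : ρ → γ → K} {A' : ρ' → γ → K} {T : Set γ}
    (h : Spans A T)
    (hA : ∀ r, ∃ u ∈ Submodule.span K (Set.range A'), ∀ t ∈ T, A r t = u t) :
    Spans A' T := by
  have key : ∀ v ∈ Submodule.span K (Set.range A),
      ∃ u ∈ Submodule.span K (Set.range A'), ∀ t ∈ T, v t = u t := by
    intro v hv
    induction hv using Submodule.span_induction with
    | mem v hv => obtain ⟨r, rfl⟩ := hv; exact hA r
    | zero => exact ⟨0, Submodule.zero_mem _, fun _ _ => rfl⟩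
    | add v w _ _ hv hw =>
      obtain ⟨a, ha, ha'⟩ := hv
      obtain ⟨b, hb, hb'⟩ := hw
      exact ⟨a + b, Submodule.add_mem _ ha hb, fun t ht => by simp [ha' t ht, hb' t ht]⟩
    | smul s v _ hv =>
      obtain ⟨a, ha, ha'⟩ := hv
      exact ⟨s • a, Submodule.smul_mem _ _ ha, fun t ht => by simp [ha' t ht]⟩
  intro y
  obtain ⟨v, hv, hvy⟩ := h y
  obtain ⟨u, hu, huv⟩ := key v hv
  exact ⟨u, hu, fun t ht => (huv t ht).symm.trans (hvy t ht)⟩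

/-- Vectors that fit a target on `T` may be wrong on `T' \ T`. The vectors in `hnew` act as unit
vectors on `T'`, so they repair each new column without disturbing any other. -/
theorem Spans.extend {ρ ρ' γ : Type*} [Fintype γ] {A : ρ → γ → K} {A' : ρ' → γ → K}
    {T T' : Set γ} (h : Spans A T)
    (hA : ∀ r, ∃ u ∈ Submodule.span K (Set.range A'), ∀ t ∈ T', A r t = u t) (hT : T ⊆ T')
    (hnew : ∀ t ∈ T', t ∉ T → ∃ u ∈ Submodule.span K (Set.range A'),
      u t = 1 ∧ ∀ s ∈ T', s ≠ t → u s = 0) :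
    Spans A' T' := by
  classical
  intro y
  have h' : Spans A' T := h.of_eqOn fun r => by
    obtain ⟨u, hu, hu'⟩ := hA r
    exact ⟨u, hu, fun t ht => hu' t (hT ht)⟩
  obtain ⟨u, hu, huy⟩ := h' y
  choose! e he he1 he0 using hnew
  refine ⟨u + ∑ t ∈ Finset.univ.filter (fun t => t ∈ T' ∧ t ∉ T), (y t - u t) • e t,
    Submodule.add_mem _ hu (Submodule.sum_mem _ fun t ht => ?_), fun s hs => ?_⟩
  · simp only [Finset.mem_filter, Finset.mem_univ, true_and] at ht
    exact Submodule.smul_mem _ _ (he t ht.1 ht.2)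
  · rw [Pi.add_apply, Finset.sum_apply]
    by_cases hsT : s ∈ T
    · rw [Finset.sum_eq_zero, add_zero, huy s hsT]
      intro t ht
      simp only [Finset.mem_filter, Finset.mem_univ, true_and] at ht
      have : s ≠ t := fun h => ht.2 (h ▸ hsT)
      simp [he0 t ht.1 ht.2 s hs this]
    · rw [Finset.sum_eq_single s]
      · simp [he1 s hs hsT]
      · intro t ht hne
        simp only [Finset.mem_filter, Finset.mem_univ, true_and] at ht
        simp [he0 t ht.1 ht.2 s hs hne.symm]
      · intro hn
        simp [hs, hsT] at hn

theorem Spans.exists_leftInverse {ρ γ : Type*} [Fintype ρ] [Fintype γ] [DecidableEq γ]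
    {A : ρ → γ → K} {T : Set γ} (h : Spans A T) :
    ∃ Z : Matrix T ρ K, Z * Matrix.of (fun r (t : T) => A r t) = 1 := by
  classical
  choose u hu hut using fun t : T => h (Pi.single t.1 1)
  choose Z hZ using fun t => (Submodule.mem_span_range_iff_exists_fun K).1 (hu t)
  refine ⟨Matrix.of Z, ?_⟩
  ext s t
  have := hut s t t.2
  rw [← hZ, Finset.sum_apply] at this
  simp only [Pi.smul_apply, smul_eq_mul] at this
  rw [Matrix.mul_apply]
  simp only [Matrix.of_apply]
  rw [this, Matrix.one_apply, Pi.single_apply]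
  simp [Subtype.ext_iff, eq_comm]

theorem Spans.of_leftInverse {ρ γ : Type*} [Fintype ρ] [Fintype γ] [DecidableEq γ]
    {A : ρ → γ → K} {T : Set γ} [DecidablePred (· ∈ T)] (Z : Matrix T ρ K)
    (h : Z * Matrix.of (fun r (t : T) => A r t) = 1) : Spans A T := by
  intro y
  refine ⟨∑ r, (Matrix.vecMul (fun t : T => y t) Z) r • A r,
    Submodule.sum_mem _ fun r _ => Submodule.smul_mem _ _ (Submodule.subset_span ⟨r, rfl⟩), ?_⟩
  intro t ht
  have h1 : Matrix.vecMul (Matrix.vecMul (fun t : T => y t) Z)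
      (Matrix.of (fun r (t : T) => A r t)) = fun t : T => y t := by
    rw [Matrix.vecMul_vecMul, h, Matrix.vecMul_one]
  have := congrFun h1 ⟨t, ht⟩
  rw [Finset.sum_apply]
  exact this

/-- Spanning is an open condition: for a left inverse `Z` of `A` on `T`, the determinant of `Z (A +
εB)` is a polynomial in `ε` with value `1` at `0`. -/
theorem Spans.exists_perturbation [Infinite K] {ρ γ : Type*} [Fintype ρ] [Fintype γ]
    {A : ρ → γ → K} {T : Set γ} (h : Spans A T) (B : ρ → γ → K) :
    ∃ ε : K, ε ≠ 0 ∧ Spans (fun r => A r + ε • B r) T := by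
  classical
  obtain ⟨Z, hZ⟩ := h.exists_leftInverse
  let P : Matrix ρ T (Polynomial K) :=
    Matrix.of fun r t => Polynomial.C (A r t) + Polynomial.X * Polynomial.C (B r t)
  let D : Polynomial K := (Z.map Polynomial.C * P).det
  have hD : ∀ ε : K, D.eval ε =
      (Z * Matrix.of (fun r (t : T) => (A r + ε • B r) t)).det := by
    intro ε
    rw [← Polynomial.coe_evalRingHom, RingHom.map_det]
    congr 1
    rw [RingHom.mapMatrix_apply, Matrix.map_mul]
    congr 1
    · ext; simp
    · ext; simp [P]; ring
  have hD0 : D ≠ 0 := by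
    intro h0
    have := hD 0
    simp [h0, hZ] at this
  -- The factor `X` makes the non-root `ε` nonzero as well.
  obtain ⟨ε, hε⟩ : ∃ ε : K, (Polynomial.X * D).eval ε ≠ 0 := by
    by_contra! hcon
    exact mul_ne_zero Polynomial.X_ne_zero hD0 (Polynomial.funext (by simpa using hcon))
  rw [Polynomial.eval_mul, Polynomial.eval_X] at hε
  refine ⟨ε, left_ne_zero_of_mul hε, ?_⟩
  have hu := right_ne_zero_of_mul hε
  rw [hD] at hu
  refine Spans.of_leftInverse
    ((Z * Matrix.of (fun r (t : T) => (A r + ε • B r) t))⁻¹ * Z) ?_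
  rw [Matrix.mul_assoc]
  exact Matrix.nonsing_inv_mul _ (isUnit_iff_ne_zero.2 hu)

/-- The generic rank is at least the rank of a specialization. -/
theorem Spans.card_le_fracRank {ρ γ σ : Type*} [Fintype ρ] [Fintype γ]
    (Φ : Matrix ρ γ (MvPolynomial σ K)) (x : σ → K) (T : Finset γ)
    (h : Spans (fun r t => MvPolynomial.eval x (Φ r t)) (T : Set γ)) :
    T.card ≤ fracRank Φ := by
  classical
  obtain ⟨Z, hZ⟩ := h.exists_leftInverse
  let ι := algebraMap (MvPolynomial σ K) (FractionRing (MvPolynomial σ K))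
  -- `Q` factors through the columns of `Φ` in `T`, and its determinant specializes to `1`, so it is
  -- nonzero generically.
  let Q : Matrix (T : Set γ) (T : Set γ) (MvPolynomial σ K) :=
    Matrix.of fun s t => ∑ r, MvPolynomial.C (Z s r) * Φ r t
  have hQ : Q.det ≠ 0 := by
    intro h0
    have h1 : MvPolynomial.eval x Q.det = 1 := by
      rw [RingHom.map_det, RingHom.mapMatrix_apply, ← Matrix.det_one (n := (T : Set γ)), ← hZ]
      congr 1
      ext
      simp [Q, Matrix.mul_apply]
    simp [h0] at h1
  have h2 : (Q.map ι).det ≠ 0 := by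
    rw [← RingHom.mapMatrix_apply, ← RingHom.map_det]
    exact (map_ne_zero_iff ι (IsFractionRing.injective _ _)).2 hQ
  have h3 : (Q.map ι).rank = T.card := by
    rw [Matrix.rank_of_isUnit _ ((Matrix.isUnit_iff_isUnit_det _).2 (isUnit_iff_ne_zero.2 h2))]
    simp
  have h4 : Q.map ι = (Z.map MvPolynomial.C).map ι *
      (Φ.map ι).submatrix id (fun t : (T : Set γ) => (t : γ)) := by
    ext
    simp [Q, Matrix.mul_apply]
  rw [← h3, h4]
  exact (Matrix.rank_mul_le_right _ _).trans (Matrix.rank_submatrix_le _ _ _)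

end LinearAlgebra

/-! ### Linear order of the columns across blocks -/

section Columns

variable {n : ℕ}

/-- The sum of the first `v` members of `f`. -/
def prefixSum (f : Fin n → ℕ) (v : ℕ) : ℕ := ∑ j ∈ Finset.Icc 1 v, term f j

theorem prefixSum_succ (f : Fin n → ℕ) (v : ℕ) :
    prefixSum f (v + 1) = prefixSum f v + term f (v + 1) :=
  Finset.sum_Icc_succ_top (by omega) _

theorem term_val_add_one (f : Fin n → ℕ) (j : Fin n) : term f (j + 1) = f j := by
  rw [term, dif_pos ⟨by omega, j.2⟩]
  rfl

theorem prefixSum_val_add_one (f : Fin n → ℕ) (j : Fin n) :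
    prefixSum f (j + 1) = prefixSum f j + f j := by
  rw [prefixSum_succ, term_val_add_one]

theorem prefixSum_mono (f : Fin n → ℕ) : Monotone (prefixSum f) :=
  monotone_nat_of_le_succ fun v => by rw [prefixSum_succ]; omega

theorem sum_castLE_eq_prefixSum (f : Fin n → ℕ) (k : ℕ) (h : k ≤ n) :
    ∑ i : Fin k, f (Fin.castLE h i) = prefixSum f k := by
  induction k with
  | zero => simp [prefixSum]
  | succ k ih =>
    rw [Fin.sum_univ_castSucc, prefixSum_val_add_one f ⟨k, h⟩]
    exact congrArg (· + _) (ih (by omega))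

/-- The position of a column when all the column blocks are put side by side. -/
def pos (f : Fin n → ℕ) (t : Σ j : Fin n, Fin (f j)) : ℕ := prefixSum f t.1 + t.2

theorem finSigmaFinEquiv_val (f : Fin n → ℕ) (t : Σ j : Fin n, Fin (f j)) :
    (finSigmaFinEquiv t : ℕ) = pos f t := by
  rw [finSigmaFinEquiv_apply, sum_castLE_eq_prefixSum f _ t.1.2.le, pos]

theorem sum_eq_prefixSum (f : Fin n → ℕ) : ∑ j, f j = prefixSum f n :=
  sum_castLE_eq_prefixSum f n le_rfl

theorem exists_pos_eq (f : Fin n → ℕ) {p : ℕ} (hp : p < prefixSum f n) : ∃ t, pos f t = p := by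
  rw [← sum_eq_prefixSum] at hp
  refine ⟨finSigmaFinEquiv.symm ⟨p, hp⟩, ?_⟩
  rw [← finSigmaFinEquiv_val, Equiv.apply_symm_apply]

theorem card_pos_lt (f : Fin n → ℕ) {p : ℕ} (hp : p ≤ prefixSum f n) :
    (Finset.univ.filter fun t => pos f t < p).card = p := by
  rw [← sum_eq_prefixSum] at hp
  have : (Finset.univ.filter fun t => pos f t < p).map finSigmaFinEquiv.toEmbedding =
      Finset.univ.filter fun a : Fin (∑ j, f j) => (a : ℕ) < p := by
    ext a
    simp only [Finset.mem_map_equiv, Finset.mem_filter, Finset.mem_univ, true_and]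
    rw [← finSigmaFinEquiv_val, Equiv.apply_symm_apply]
  rw [← Finset.card_map finSigmaFinEquiv.toEmbedding, this, Fin.card_filter_val_lt]
  omega

theorem lt_of_pos_lt (f : Fin n → ℕ) {t : Σ j : Fin n, Fin (f j)} {v : ℕ}
    (h : pos f t < prefixSum f v) : (t.1 : ℕ) < v := by
  by_contra! hv
  have := prefixSum_mono f hv
  unfold pos at h
  omega

theorem le_of_le_pos (f : Fin n → ℕ) {t : Σ j : Fin n, Fin (f j)} {v : ℕ}
    (h : prefixSum f v ≤ pos f t) : v ≤ (t.1 : ℕ) := by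
  by_contra! hv
  have h1 := prefixSum_mono f (show (t.1 : ℕ) + 1 ≤ v from hv)
  rw [prefixSum_val_add_one] at h1
  unfold pos at h
  have := t.2.2
  omega

end Columns

/-! ### Capturing new columns with one more row block -/

section Specialization

variable {K : Type*} [Field K] {m n : ℕ} {c : Fin m → ℕ} {f : Fin n → ℕ}

/-- The rows of the matrix obtained from `φ^{II1}` by giving the value `x i j d` to the
indeterminate of index `d` (counted from `0`) in the block `(i, j)`. -/
def specRow (c : Fin m → ℕ) (f : Fin n → ℕ) (x : Fin m → Fin n → ℕ → K)
    (r : Σ i : Fin m, Fin (c i)) (t : Σ j : Fin n, Fin (f j)) : K :=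
  if (r.2 : ℕ) ≤ t.2 ∧ (t.2 : ℕ) - r.2 < f t.1 + 1 - c r.1 then x r.1 t.1 (t.2 - r.2) else 0

theorem eval_phiII1 (x : Fin m → Fin n → ℕ → K) (r : Σ i : Fin m, Fin (c i))
    (t : Σ j : Fin n, Fin (f j)) :
    MvPolynomial.eval (fun p : Param c f => x p.1.1 p.1.2 p.2) (phiII1 K c f r t) =
      specRow c f x r t := by
  simp only [phiII1, Matrix.of_apply, entry, specRow]
  split_ifs <;> simp

theorem specRow_update_of_ne (x : Fin m → Fin n → ℕ → K) {i : Fin m} (g : Fin n → ℕ → K)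
    {r : Σ i : Fin m, Fin (c i)} (h : r.1 ≠ i) :
    specRow c f (Function.update x i g) r = specRow c f x r := by
  funext t
  simp [specRow, h]

theorem specRow_eq_zero {x : Fin m → Fin n → ℕ → K} {r : Σ i : Fin m, Fin (c i)}
    (h : x r.1 = 0) : specRow c f x r = 0 := by
  funext t
  simp [specRow, h]

/-- The next `c i` columns lie in one block, so a single diagonal of ones, starting at column
`t₀.2`, turns the new rows into unit vectors at exactly these columns. -/
theorem spans_of_fits {x : Fin m → Fin n → ℕ → K} {i : Fin m} (hx : x i = 0)
    (t₀ : Σ j : Fin n, Fin (f j)) (hfit : t₀.2 + c i ≤ f t₀.1)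
    (h : Spans (specRow c f x) {t | pos f t < pos f t₀}) :
    ∃ g : Fin n → ℕ → K, Spans (specRow c f (Function.update x i g))
      {t | pos f t < pos f t₀ + c i} := by
  classical
  refine ⟨fun j d => if j = t₀.1 ∧ d = t₀.2 then 1 else 0, h.extend ?_ ?_ ?_⟩
  · intro r
    by_cases hr : r.1 = i
    · exact ⟨0, Submodule.zero_mem _, fun t _ => by rw [specRow_eq_zero (hr ▸ hx)]⟩
    · exact ⟨_, Submodule.subset_span ⟨r, rfl⟩, fun t _ => by rw [specRow_update_of_ne _ _ hr]⟩
  · intro t ht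
    simp only [Set.mem_ofPred_eq] at ht ⊢
    omega
  · rintro ⟨j, l⟩ ht ht'
    obtain ⟨j₀, l₀⟩ := t₀
    simp only [Set.mem_ofPred_eq, not_lt] at ht ht' hfit
    have h1 := prefixSum_val_add_one f j₀
    have h2 : (j : ℕ) < j₀ + 1 := lt_of_pos_lt f (t := ⟨j, l⟩) (v := j₀ + 1)
      (by simp only [pos] at ht ht' ⊢; omega)
    have h3 : (j₀ : ℕ) ≤ j := le_of_le_pos f (t := ⟨j, l⟩) (by simp only [pos] at ht ht' ⊢; omega)
    obtain rfl : j = j₀ := Fin.ext (by omega)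
    simp only [pos] at ht ht'
    refine ⟨_, Submodule.subset_span ⟨⟨i, ⟨l - l₀, by omega⟩⟩, rfl⟩, ?_, ?_⟩
    · simp only [specRow, Function.update_self]
      rw [if_pos (by omega), if_pos ⟨trivial, by omega⟩]
    · rintro ⟨j', l'⟩ - hne
      simp only [specRow, Function.update_self]
      split_ifs with h4 h5
      · obtain ⟨rfl, h5⟩ := h5
        exact absurd (by congr 1; exact Fin.ext (by omega)) hne
      · rfl
      · rfl

/-- The new columns are the end of block `j₀` and the start of block `j₀ + 1`. Put `ε` on the last
admissible diagonal of the former and `1` on the first diagonal of the latter. The lower rows,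
divided by `ε`, are unit vectors in block `j₀`. The upper rows are unit vectors in block `j₀ + 1`,
up to an error of order `ε` in columns already covered. The limit configuration `A` spans, hence so
does `A + εB` for a suitable `ε ≠ 0`. -/
theorem spans_of_straddles [Infinite K] {x : Fin m → Fin n → ℕ → K} {i : Fin m} (hx : x i = 0)
    (t₀ : Σ j : Fin n, Fin (f j)) {v : ℕ} (hv : ∀ j : Fin n, (j : ℕ) < v → c i ≤ f j)
    (hfit : f t₀.1 < t₀.2 + c i) (hlt : pos f t₀ < prefixSum f v)
    (h : Spans (specRow c f x) {t | pos f t < pos f t₀}) :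
    ∃ g : Fin n → ℕ → K, Spans (specRow c f (Function.update x i g))
      {t | pos f t < min (pos f t₀ + c i) (prefixSum f v)} := by
  classical
  obtain ⟨j₀, l₀⟩ := t₀
  have hj₀ := hv _ (lt_of_pos_lt f hlt)
  have hF := prefixSum_val_add_one f j₀
  simp only at hfit hj₀
  let A : (Σ i : Fin m, Fin (c i)) → (Σ j : Fin n, Fin (f j)) → K := fun r t =>
    if r.1 = i then
      if l₀ + c i ≤ r.2 + f j₀ then
        if t.1 = j₀ ∧ t.2 + c i = f j₀ + r.2 then 1 else 0
      else if (t.1 : ℕ) = j₀ + 1 ∧ (t.2 : ℕ) = r.2 then 1 else 0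
    else specRow c f x r t
  let B : (Σ i : Fin m, Fin (c i)) → (Σ j : Fin n, Fin (f j)) → K := fun r t =>
    if r.1 = i ∧ r.2 + f j₀ < l₀ + c i ∧ t.1 = j₀ ∧ t.2 + c i = f j₀ + r.2 then 1 else 0
  have hA : Spans A {t | pos f t < min (pos f ⟨j₀, l₀⟩ + c i) (prefixSum f v)} := by
    refine h.extend ?_ ?_ ?_
    · intro r
      by_cases hr : r.1 = i
      · exact ⟨0, Submodule.zero_mem _, fun t _ => by rw [specRow_eq_zero (hr ▸ hx)]⟩
      · exact ⟨_, Submodule.subset_span ⟨r, rfl⟩, fun t _ => by simp only [A, if_neg hr]⟩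
    · intro t ht
      simp only [Set.mem_ofPred_eq] at ht ⊢
      omega
    · rintro ⟨j, l⟩ ht ht'
      simp only [Set.mem_ofPred_eq, not_lt, lt_min_iff] at ht ht'
      have h2 : (j₀ : ℕ) ≤ j :=
        le_of_le_pos f (t := ⟨j, l⟩) (by simp only [pos] at ht ht' ⊢; omega)
      -- Block `j₀ + 1` has at least `c i` columns when it lies in the segment, so no third block is
      -- reached.
      have h3 : (j : ℕ) ≤ j₀ + 1 := by
        by_contra! h4
        have h5 := lt_of_pos_lt f ht.2
        simp only at h5
        have h6 := prefixSum_val_add_one f ⟨j₀ + 1, by omega⟩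
        have h7 := hv ⟨j₀ + 1, by omega⟩ (by simp only; omega)
        have h8 := prefixSum_mono f (show (j₀ : ℕ) + 1 + 1 ≤ j from h4)
        simp only [pos] at ht h6
        omega
      obtain h4 | h4 : (j : ℕ) = j₀ ∨ (j : ℕ) = j₀ + 1 := by omega
      · obtain rfl : j = j₀ := Fin.ext h4
        simp only [pos] at ht ht'
        refine ⟨_, Submodule.subset_span ⟨⟨i, ⟨l + c i - f j, by omega⟩⟩, rfl⟩, ?_, ?_⟩
        · simp only [A, if_true]
          rw [if_pos (by omega), if_pos ⟨trivial, by omega⟩]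
        · rintro ⟨j', l'⟩ - hne
          simp only [A, if_true]
          rw [if_pos (by omega), if_neg]
          rintro ⟨rfl, h5⟩
          exact absurd (by congr 1; exact Fin.ext (by omega)) hne
      · simp only [pos, h4] at ht ht'
        refine ⟨_, Submodule.subset_span ⟨⟨i, ⟨l, by omega⟩⟩, rfl⟩, ?_, ?_⟩
        · simp only [A, if_true]
          rw [if_neg (by omega), if_pos ⟨h4, trivial⟩]
        · rintro ⟨j', l'⟩ - hne
          simp only [A, if_true]
          rw [if_neg (by omega), if_neg]
          rintro ⟨h5, h6⟩
          obtain rfl : j' = j := Fin.ext (by omega)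
          exact absurd (by congr 1; exact Fin.ext h6) hne
  obtain ⟨ε, hε, hAB⟩ := hA.exists_perturbation B
  refine ⟨fun j d => if j = j₀ ∧ d + c i = f j₀ then ε else
    if (j : ℕ) = j₀ + 1 ∧ d = 0 then 1 else 0, hAB.of_eqOn ?_⟩
  rintro ⟨i', k⟩
  by_cases hr : i' = i
  swap
  · refine ⟨_, Submodule.subset_span ⟨⟨i', k⟩, rfl⟩, fun t _ => ?_⟩
    rw [specRow_update_of_ne _ _ hr]
    simp [A, B, hr]
  subst hr
  by_cases hk : l₀ + c i' ≤ k + f j₀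
  -- The row also has a `1` in block `j₀ + 1`, but at a column beyond the target, so rescaling does
  -- no harm.
  · refine ⟨ε⁻¹ • specRow c f _ ⟨i', k⟩,
      Submodule.smul_mem _ _ (Submodule.subset_span ⟨⟨i', k⟩, rfl⟩), ?_⟩
    rintro ⟨j, l⟩ ht
    simp only [Set.mem_ofPred_eq, lt_min_iff] at ht
    have hB : B ⟨i', k⟩ ⟨j, l⟩ = 0 := if_neg (by simp only; omega)
    simp only [Pi.add_apply, Pi.smul_apply, smul_eq_mul, hB, A, if_true, if_pos hk, specRow,
      Function.update_self]
    by_cases hj : j = j₀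
    · subst hj
      by_cases hl : l + c i' = f j + k
      · rw [if_pos ⟨rfl, hl⟩, if_pos (by omega), if_pos ⟨rfl, by omega⟩]
        field_simp
        simp
      · rw [if_neg (by tauto)]
        split_ifs with h1 h2 h3
        · omega
        · omega
        · simp
        · simp
    · rw [if_neg (by tauto)]
      split_ifs with h1 h2 h3
      · exact absurd h2.1 hj
      · simp only [pos, h3.1] at ht
        omega
      · simp
      · simp
  · refine ⟨specRow c f _ ⟨i', k⟩, Submodule.subset_span ⟨⟨i', k⟩, rfl⟩, ?_⟩
    rintro ⟨j, l⟩ ht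
    simp only [Set.mem_ofPred_eq, lt_min_iff] at ht
    simp only [Pi.add_apply, Pi.smul_apply, smul_eq_mul, A, B, if_true, if_neg hk, specRow,
      Function.update_self]
    by_cases hj : j = j₀
    · subst hj
      rw [if_neg (by omega)]
      by_cases hl : l + c i' = f j + k
      · rw [if_pos ⟨trivial, by omega, rfl, hl⟩, if_pos (by omega), if_pos ⟨rfl, by omega⟩]
        simp
      · rw [if_neg (by tauto)]
        split_ifs with h1 h2 h3
        · omega
        · omega
        · simp
        · simp
    · rw [if_neg (c := True ∧ _) (by tauto)]
      by_cases hj' : (j : ℕ) = j₀ + 1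
      · have h1 := hv j (lt_of_pos_lt f ht.2)
        by_cases hl : (l : ℕ) = k
        · rw [if_pos ⟨hj', hl⟩, if_pos (by omega), if_neg (by tauto), if_pos (by omega)]
          simp
        · rw [if_neg (by tauto)]
          split_ifs with h1 h2 h3
          · tauto
          · omega
          · simp
          · simp
      · rw [if_neg (by tauto)]
        split_ifs with h1 h2 h3
        · tauto
        · tauto
        · simp
        · simp

theorem Spans.mono {ρ γ : Type*} {A : ρ → γ → K} {T T' : Set γ} (h : Spans A T)
    (hT : T' ⊆ T) : Spans A T' := fun y => by
  obtain ⟨u, hu, huy⟩ := h y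
  exact ⟨u, hu, fun t ht => huy t (hT ht)⟩

theorem exists_spans_update [Infinite K] {x : Fin m → Fin n → ℕ → K} {i : Fin m} (hx : x i = 0)
    {v p : ℕ} (hvn : v ≤ n) (hv : ∀ j : Fin n, (j : ℕ) < v → c i ≤ f j)
    (h : Spans (specRow c f x) {t | pos f t < p}) :
    ∃ g : Fin n → ℕ → K, Spans (specRow c f (Function.update x i g))
      {t | pos f t < min (p + c i) (prefixSum f v)} := by
  by_cases hp : p < prefixSum f v
  · obtain ⟨t₀, rfl⟩ := exists_pos_eq f (hp.trans_le (prefixSum_mono f hvn))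
    by_cases hfit : t₀.2 + c i ≤ f t₀.1
    · obtain ⟨g, hg⟩ := spans_of_fits hx t₀ hfit h
      exact ⟨g, hg.mono fun t ht => lt_of_lt_of_le (Set.mem_ofPred_eq ▸ ht) (min_le_left _ _)⟩
    · exact spans_of_straddles hx t₀ hv (by omega) hp h
  · refine ⟨0, ?_⟩
    rw [← hx, Function.update_eq_self]
    exact h.mono fun t ht => lt_of_lt_of_le (Set.mem_ofPred_eq ▸ ht) ((min_le_right _ _).trans (not_lt.1 hp))

end Specialization

/-! ### Termination of `uSeq` and comparison of `reach` with the minimum -/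

section Indices

variable {m n : ℕ} {c : Fin m → ℕ} {f : Fin n → ℕ}

theorem maxIndex_le (m : ℕ) (P : ℕ → Prop) [DecidablePred P] : maxIndex m P ≤ m :=
  Finset.sup_le fun j hj => by simp at hj; exact hj.1.2

theorem le_maxIndex {m : ℕ} {P : ℕ → Prop} [DecidablePred P] {j : ℕ} (h1 : 1 ≤ j) (h2 : j ≤ m)
    (h : P j) : j ≤ maxIndex m P :=
  Finset.le_sup (f := id) (by simp [h1, h2, h])

theorem maxIndex_spec {m : ℕ} {P : ℕ → Prop} [DecidablePred P] (h : 0 < maxIndex m P) :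
    P (maxIndex m P) := by
  have hne : ((Finset.Icc 1 m).filter P).Nonempty := by
    by_contra hne
    rw [Finset.not_nonempty_iff_eq_empty] at hne
    simp [maxIndex, hne] at h
  obtain ⟨j, hj, hj'⟩ := Finset.exists_mem_eq_sup _ hne id
  rw [maxIndex, hj']
  exact (Finset.mem_filter.1 hj).2

theorem term_le_term (hc : Antitone c) {j k : ℕ} (h1 : 1 ≤ j) (h2 : j ≤ k) :
    term c k ≤ term c j := by
  unfold term
  split_ifs
  · exact hc (by simp only [Fin.mk_le_mk]; omega)
  · omega
  · omega
  · omega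

theorem term_pos (hc : ∀ i, 1 ≤ c i) {j : ℕ} (h1 : 1 ≤ j) (h2 : j ≤ m) : 0 < term c j := by
  rw [term, dif_pos ⟨h1, h2⟩]
  exact hc _

theorem term_of_lt (c : Fin m → ℕ) {j : ℕ} (h : m < j) : term c j = 0 :=
  dif_neg (by omega)

theorem nextV_mono (hc : Antitone c) : Monotone (nextV c f) := by
  intro u u' h
  obtain h0 | h0 := Nat.eq_zero_or_pos (nextV c f u)
  · omega
  · exact le_maxIndex h0 (maxIndex_le _ _)
      ((term_le_term hc (by omega) (by omega)).trans (maxIndex_spec h0))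

/-- With `v = nextV c f u`, maximality of `v`, or the default `f_{n+1} = 0`, gives `f_{v+1} <
c_{u+1}`. Thus `u + 1` is a candidate for the next maximum. -/
theorem lt_nextU_nextV (hc : ∀ i, 1 ≤ c i) {u : ℕ} (hu : u < m) :
    u < nextU c f (nextV c f u) := by
  refine le_maxIndex (by omega) hu ?_
  by_cases hv : nextV c f u < n
  · by_contra! h
    have := le_maxIndex (P := fun i => term c (u + 1) ≤ term f i) (by omega) hv h
    unfold nextV at *
    omega
  · rw [term_of_lt f (by omega)]
    exact term_pos hc (by omega) hu

theorem nextU_nextV_self (hc : ∀ i, 1 ≤ c i) : nextU c f (nextV c f m) = m := by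
  refine le_antisymm (maxIndex_le _ _) ?_
  have hv : nextV c f m = n := by
    refine le_antisymm (maxIndex_le _ _) ?_
    obtain rfl | hn := Nat.eq_zero_or_pos n
    · omega
    · exact le_maxIndex hn le_rfl (by rw [term_of_lt c (by omega)]; omega)
  obtain h0 | h0 := Nat.eq_zero_or_pos m
  · omega
  · refine le_maxIndex h0 le_rfl ?_
    rw [hv, term_of_lt f (by omega)]
    exact term_pos hc h0 le_rfl

theorem uSeq_le (c : Fin m → ℕ) (f : Fin n → ℕ) : ∀ l, uSeq c f l ≤ m
  | 0 => Nat.zero_le _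
  | _ + 1 => maxIndex_le _ _

/-- Growth is guaranteed only from `u_1` on, because `v_0 = 0` need not be `nextV c f u_0`; hence
the shift by one. -/
theorem min_le_uSeq (hc : ∀ i, 1 ≤ c i) (l : ℕ) : min l m ≤ uSeq c f (l + 1) := by
  induction l with
  | zero => simp
  | succ l ih =>
    have hle := uSeq_le c f (l + 1)
    have h : uSeq c f (l + 2) = nextU c f (nextV c f (uSeq c f (l + 1))) := rfl
    rw [h]
    obtain h1 | h1 := hle.lt_or_eq
    · have := lt_nextU_nextV (f := f) hc h1
      omega
    · rw [h1, nextU_nextV_self hc]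
      omega

theorem exists_uSeq_eq (hc : ∀ i, 1 ≤ c i) : ∃ l, 1 ≤ l ∧ uSeq c f l = m :=
  ⟨m + 1, by omega, le_antisymm (uSeq_le _ _ _) (by simpa using min_le_uSeq (f := f) hc m)⟩

theorem prefixSum_add_sum_Icc (c : Fin m → ℕ) {u k : ℕ} (h : u ≤ k) :
    prefixSum c u + ∑ j ∈ Finset.Icc (u + 1) k, term c j = prefixSum c k := by
  induction k, h using Nat.le_induction with
  | base => simp
  | succ k hk ih => rw [Finset.sum_Icc_succ_top (by omega), prefixSum_succ, ← ih, add_assoc]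

/-- The number of columns that the first `i` row blocks fill greedily from the left. -/
def reach (c : Fin m → ℕ) (f : Fin n → ℕ) : ℕ → ℕ
  | 0 => 0
  | i + 1 => min (reach c f i + term c (i + 1)) (prefixSum f (nextV c f i))

theorem reach_le (c : Fin m → ℕ) (f : Fin n → ℕ) : ∀ i, reach c f i ≤ prefixSum f n
  | 0 => Nat.zero_le _
  | _ + 1 => (min_le_right _ _).trans (prefixSum_mono f (maxIndex_le _ _))

/-- Follow the recursion back to the last index where the cap `prefixSum f (nextV c f i)` was
attained; after it, whole row blocks are added. Sums are moved across to avoid subtraction. -/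
theorem reach_eq (c : Fin m → ℕ) (f : Fin n → ℕ) (k : ℕ) :
    reach c f k = prefixSum c k ∨
      ∃ i < k, reach c f k + prefixSum c (i + 1) =
        prefixSum f (nextV c f i) + prefixSum c k := by
  induction k with
  | zero => exact Or.inl rfl
  | succ k ih =>
    obtain h | h := min_choice (reach c f k + term c (k + 1)) (prefixSum f (nextV c f k))
    · obtain h1 | ⟨i, hi, h1⟩ := ih
      · left
        rw [reach, h, prefixSum_succ, h1]
      · refine Or.inr ⟨i, by omega, ?_⟩
        rw [reach, h, prefixSum_succ c k]
        omega
    · exact Or.inr ⟨k, by omega, by rw [reach, h]⟩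

/-- If the cap was last attained at `i`, take `l` with `u_l ≤ i < u_{l+1}`. Then `v_l ≤ nextV c f
i`, and fewer row blocks follow `u_{l+1}` than follow `i + 1` or equally many, so both parts of the
`l`-th value are no larger. If no cap was attained, `l = 0` works because `v_0 = 0`. -/
theorem exists_value_le_reach (hc : Antitone c) {w : ℕ} (hw : 1 ≤ w) (hwm : uSeq c f w = m) :
    ∃ l ≤ w - 1, prefixSum f (vSeq c f l) +
      ∑ j ∈ Finset.Icc (uSeq c f (l + 1) + 1) m, term c j ≤ reach c f m := by
  obtain h | ⟨i, hi, h⟩ := reach_eq c f m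
  · refine ⟨0, by omega, ?_⟩
    have h1 := prefixSum_add_sum_Icc c (uSeq_le c f 1)
    have h2 : prefixSum f (vSeq c f 0) = 0 := by simp [vSeq, prefixSum]
    rw [h, h2, zero_add, zero_add]
    omega
  · have hex : ∃ l, i < uSeq c f l := ⟨w, by omega⟩
    have hl0 : Nat.find hex ≠ 0 := fun h0 => by
      have := Nat.find_spec hex
      rw [h0] at this
      exact Nat.not_lt_zero _ this
    obtain ⟨l, hl⟩ := Nat.exists_eq_succ_of_ne_zero hl0
    have hlt : i < uSeq c f (l + 1) := by
      have := Nat.find_spec hex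
      rwa [hl] at this
    have hle : uSeq c f l ≤ i := not_lt.1 (Nat.find_min hex (by omega))
    have hlw : l + 1 ≤ w := by
      have := Nat.find_min' hex (m := w) (by omega)
      omega
    refine ⟨l, by omega, ?_⟩
    have h1 := prefixSum_add_sum_Icc c (uSeq_le c f (l + 1))
    have h2 := prefixSum_mono c (show i + 1 ≤ uSeq c f (l + 1) from hlt)
    have h3 : vSeq c f l ≤ nextV c f i := by
      cases l with
      | zero => exact Nat.zero_le _
      | succ l => exact nextV_mono hc hle
    have h4 := prefixSum_mono f h3
    omega

end Indices

/-! ### The two bounds for the rank -/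

section Rank

variable {K : Type*} [Field K] {m n : ℕ} {c : Fin m → ℕ} {f : Fin n → ℕ}

/-- Row blocks not yet treated are kept at zero, since each greedy step overwrites a zero block. -/
theorem exists_spans_reach [Infinite K] (hf : Antitone f) {i : ℕ} (hi : i ≤ m) :
    ∃ x : Fin m → Fin n → ℕ → K, (∀ i' : Fin m, i ≤ i' → x i' = 0) ∧
      Spans (specRow c f x) {t | pos f t < reach c f i} := by
  induction i with
  | zero => exact ⟨0, fun _ _ => rfl, fun y => ⟨0, Submodule.zero_mem _, by simp [reach]⟩⟩
  | succ i ih =>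
    obtain ⟨x, hx, h⟩ := ih (by omega)
    have hv : ∀ j : Fin n, (j : ℕ) < nextV c f i → c ⟨i, hi⟩ ≤ f j := by
      intro j hj
      rw [← term_val_add_one c ⟨i, hi⟩, ← term_val_add_one f j]
      exact (maxIndex_spec (P := fun j => term c (i + 1) ≤ term f j)
        (by unfold nextV at hj; omega)).trans (term_le_term hf (by omega) hj)
    obtain ⟨g, hg⟩ := exists_spans_update (hx ⟨i, hi⟩ le_rfl) (maxIndex_le _ _) hv h
    refine ⟨Function.update x ⟨i, hi⟩ g, fun i' hi' => ?_, ?_⟩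
    · rw [Function.update_of_ne (by rintro rfl; simp at hi'), hx _ (by omega)]
    · rw [← term_val_add_one c ⟨i, hi⟩] at hg
      exact hg

theorem reach_le_fracRank [Infinite K] (hf : Antitone f) :
    reach c f m ≤ fracRank (phiII1 K c f) := by
  obtain ⟨x, -, hx⟩ := exists_spans_reach (K := K) (c := c) hf le_rfl
  rw [← card_pos_lt f (reach_le c f m)]
  refine Spans.card_le_fracRank _ (fun p => x p.1.1 p.1.2 p.2) _ ?_
  simp only [eval_phiII1]
  simpa using hx

theorem fracRank_le (hc : Antitone c) (hf : Antitone f) {v : ℕ} (hv : v ≤ n) :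
    fracRank (phiII1 K c f) ≤
      prefixSum f v + ∑ j ∈ Finset.Icc (nextU c f v + 1) m, term c j := by
  classical
  have hu : nextU c f v ≤ m := maxIndex_le _ _
  have h1 := rank_le_card_add_card
    ((phiII1 K c f).map (algebraMap _ (FractionRing (MvPolynomial (Param c f) K))))
    (Finset.univ.filter fun r => ¬ pos c r < prefixSum c (nextU c f v))
    (Finset.univ.filter fun t => pos f t < prefixSum f v) (by
      intro r hr t ht
      simp only [Finset.mem_filter, Finset.mem_univ, true_and, not_lt, not_le] at hr ht
      have h2 := lt_of_pos_lt c hr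
      have h3 := le_of_le_pos f ht
      have h4 : term f (v + 1) < term c (nextU c f v) :=
        maxIndex_spec (P := fun j => term c j > term f (v + 1)) (by unfold nextU at h2; omega)
      have h5 := term_le_term hc (j := r.1 + 1) (k := nextU c f v) (by omega) (by omega)
      have h6 := term_le_term hf (j := v + 1) (k := t.1 + 1) (by omega) (by omega)
      rw [term_val_add_one] at h5 h6
      rw [Matrix.map_apply, phiII1, Matrix.of_apply, entry, dif_neg (by omega), map_zero])
  rw [card_pos_lt f (prefixSum_mono f hv)] at h1
  have h2 := Finset.card_filter_add_card_filter_not (s := Finset.univ)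
    (fun r => pos c r < prefixSum c (nextU c f v))
  rw [card_pos_lt c (prefixSum_mono c hu), Finset.card_univ, Fintype.card_sigma] at h2
  simp only [Fintype.card_fin] at h2
  rw [sum_eq_prefixSum] at h2
  have h3 := prefixSum_add_sum_Icc c hu
  unfold fracRank
  omega

theorem vSeq_le (c : Fin m → ℕ) (f : Fin n → ℕ) : ∀ l, vSeq c f l ≤ n
  | 0 => Nat.zero_le _
  | _ + 1 => maxIndex_le _ _

end Rank

end Kron

theorem proposition7 (K : Type*) [Field K] [IsAlgClosed K] (m n : ℕ)
    (c : Fin m → ℕ) (f : Fin n → ℕ)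
    (hc : ∀ i, 1 ≤ c i) (hf : ∀ j, 1 ≤ f j) (hc' : Antitone c) (hf' : Antitone f) :
    ∃ w : ℕ, IsLeast {l : ℕ | 1 ≤ l ∧ Kron.uSeq c f l = m} w ∧
      IsLeast
        {x : ℕ | ∃ i : ℕ, i ≤ w - 1 ∧
          x = ∑ j ∈ Finset.Icc 1 (Kron.vSeq c f i), Kron.term f j +
            ∑ j ∈ Finset.Icc (Kron.uSeq c f (i + 1) + 1) (Kron.uSeq c f w), Kron.term c j}
        (Kron.fracRank (Kron.phiII1 K c f)) := by
  classical
  have hex := Kron.exists_uSeq_eq (f := f) hc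
  obtain ⟨hw, hwm⟩ := Nat.find_spec hex
  have hinf : Infinite K := IsAlgClosed.instInfinite
  have hupper : ∀ l, Kron.fracRank (Kron.phiII1 K c f) ≤
      ∑ j ∈ Finset.Icc 1 (Kron.vSeq c f l), Kron.term f j +
        ∑ j ∈ Finset.Icc (Kron.uSeq c f (l + 1) + 1) m, Kron.term c j :=
    fun l => Kron.fracRank_le hc' hf' (Kron.vSeq_le c f l)
  refine ⟨Nat.find hex, ⟨⟨hw, hwm⟩, fun l hl => Nat.find_min' hex hl⟩, ?_⟩
  rw [hwm]
  constructor
  · obtain ⟨l, hl, hle⟩ := Kron.exists_value_le_reach hc' hw hwm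
    exact ⟨l, hl, le_antisymm (hupper l) (hle.trans (Kron.reach_le_fracRank hf'))⟩
  · rintro _ ⟨l, -, rfl⟩
    exact hupper l
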